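/- Let $\{Z(n), n\ge 0\}$ be a Galton--Watson branching process with $Z(0)=1$ and offspring number $\xi$ taking values in $\{0,1,2,\dots\}$, let $f(s)=\mathbf{E}s^{\xi}$, $0\le s\le 1$, and let $f_0(s)=s$, $f_n(s)=f(f_{n-1}(s))$ for $n\ge 1$ be the iterates of $f$. Assume that, for some $\alpha\in(0,1)$, $$\mathbf{E}\xi=1,\qquad f(s)=s+(1-s)^{1+\alpha}L(1-s),\quad 0\le s\le 1,$$ where $L$ is slowly varying at zero, that is, $L(z)>0$ for all sufficiently small $z>0$ and $L(yz)/L(z)\to 1$ as $z\downarrow 0$ for every $y>0$. Let $\varphi(n)$, $n=1,2,\dots$, be a deterministic real sequence such that $\varphi(n)\to\infty$ and $\varphi(n)/n\to 0$ as $n\to\infty$, and read $f_{\varphi(n)}$ as $f_{\lfloor\varphi(n)\rfloor}$ when $\varphi(n)$ is not an integer. Then, as $n\to\infty$, $$\mathbf{P}\bigl(0<(1-f_{\varphi(n)}(0))\,Z(n)\le 1\bigr)\sim\frac{1-f_n(0)}{\alpha n}\,\frac{1}{\Gamma(1+\alpha)}\,\varphi(n),$$ where $\Gamma$ is the Gamma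 function and $a_n\sim b_n$ means $a_n/b_n\to 1$. -/

import Mathlib

open MeasureTheory ProbabilityTheory Filter Topology Asymptotics

/-- The probability generating function `s ↦ ∑ k, ν {k} s ^ k` of a law `ν` on `ℕ`. -/
noncomputable def pgf (ν : Measure ℕ) (s : ℝ) : ℝ := ∫ k, s ^ k ∂ν

/-- `L` is slowly varying at `0` from the right. -/
def SlowlyVaryingAtZero (L : ℝ → ℝ) : Prop :=
  (∀ᶠ z in 𝓝[>] (0 : ℝ), 0 < L z) ∧
    ∀ y : ℝ, 0 < y → Tendsto (fun z => L (y * z) / L z) (𝓝[>] 0) (𝓝 1)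

/-- The branching process started from one particle, where `ξ n i` is the number of children of
the `i`-th particle of generation `n`. -/
def branching {Ω : Type*} (ξ : ℕ → ℕ → Ω → ℕ) : ℕ → Ω → ℕ
  | 0 => fun _ => 1
  | n + 1 => fun ω => ∑ i ∈ Finset.range (branching ξ n ω), ξ n i ω

/-- `Z` is a Galton-Watson process on `(Ω, P)` with offspring law `ν` and a single founding
ancestor: it is the branching process of an array of independent offspring numbers of law `ν`. -/
def IsGaltonWatson {Ω : Type*} [MeasurableSpace Ω] (Z : ℕ → Ω → ℕ) (ν : Measure ℕ)
    (P : Measure Ω) : Prop :=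
  ∃ ξ : ℕ → ℕ → Ω → ℕ,
    (∀ n i, HasLaw (ξ n i) ν P) ∧
    iIndepFun (fun (k : ℕ × ℕ) => ξ k.1 k.2) P ∧
    ∀ n, Z n =ᵐ[P] branching ξ n

/-! Put g(x) = f(1 - x) - (1 - x) and T x = x - g x, so that T^n 1 = e_n = 1 - f_n(0). The function
g is convex and regularly varying of index 1 + α. With h(x) = g(x) / x, each application of T near 0
increases 1 / h by asymptotically α. Hence h(e_n) ~ 1 / (α n), and the descent from 1 to u takes
about 1 / (α h(u)) steps (`tendsto_nat_mul_div_iterate`, `tendsto_mul_of_iterate_lt_le`).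

Let m = ⌊φ n⌋. The Laplace transform at c of e_m Z(n) on {Z(n) > 0} is f_n(exp(-c e_m)) - f_n(0) =
e_n - T^n u with u = 1 - exp(-c e_m) ~ c e_m. This u sits k ~ c^(-α) m steps down the orbit of 1, so
T^n u lies between e_(n+k+1) and e_(n+k). Since k = o(n), e_n - e_(n+k) ~ k g(e_n) ~ k e_n / (α n)
(`tendsto_iterate_sub_exp`).

Divided by m e_n / (α n), the transforms tend to c^(-α), the transform of the infinite measure
x^(α-1) dx / Γ(α), which gives [0, 1] mass 1 / Γ(1 + α). The continuity theorem
`tendsto_measureReal_Iic_of_tendsto_laplace` turns this into the claim. -/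

/-! ### Regular variation and iteration of x ↦ x - g x. -/

section RegularVariation

variable {g : ℝ → ℝ} {α : ℝ}

theorem monotoneOn_div_self_of_convexOn (hg : ConvexOn ℝ (Set.Icc 0 1) g) (hg0 : g 0 = 0) :
    MonotoneOn (fun x => g x / x) (Set.Ioc 0 1) := by
  intro x hx y hy hxy
  have hx0 := hx.1
  have hy0 := hy.1
  have h1 : 0 ≤ 1 - x / y := by rw [sub_nonneg, div_le_one hy0]; exact hxy
  have h2 : 0 ≤ x / y := by positivity
  have h := hg.2 (Set.left_mem_Icc.2 zero_le_one) (Set.Ioc_subset_Icc_self hy) h1 h2 (by ring)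
  simp only [smul_eq_mul, mul_zero, zero_add, hg0] at h
  rw [div_mul_cancel₀ _ hy0.ne'] at h
  show g x / x ≤ g y / y
  rw [div_le_div_iff₀ hx0 hy0]
  have := mul_le_mul_of_nonneg_right h hy0.le
  calc g x * y ≤ x / y * g y * y := this
    _ = g y * x := by field_simp

theorem tendsto_div_self_ratio
    (hreg : ∀ c : ℝ, 0 < c → Tendsto (fun x => g (c * x) / g x) (𝓝[>] 0) (𝓝 (c ^ (1 + α))))
    {c : ℝ} (hc : 0 < c) :
    Tendsto (fun x => g (c * x) / (c * x) / (g x / x)) (𝓝[>] 0) (𝓝 (c ^ α)) := by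
  have h := (hreg c hc).div_const c
  have e : c ^ (1 + α) / c = c ^ α := by
    rw [Real.rpow_add hc, Real.rpow_one]; field_simp
  rw [e] at h
  refine h.congr' ?_
  filter_upwards [self_mem_nhdsWithin] with x (hx : 0 < x)
  field_simp

/-- Monotone regularly varying functions respect asymptotic proportionality of arguments. -/
theorem tendsto_ratio_of_monotoneOn {h : ℝ → ℝ} (hmono : MonotoneOn h (Set.Ioc 0 1))
    (hpos : ∀ x ∈ Set.Ioc (0 : ℝ) 1, 0 < h x)
    (hreg : ∀ c : ℝ, 0 < c → Tendsto (fun x => h (c * x) / h x) (𝓝[>] 0) (𝓝 (c ^ α)))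
    {ι : Type*} {l : Filter ι} {u v : ι → ℝ} {c : ℝ} (hc : 0 < c)
    (hu : Tendsto u l (𝓝[>] 0)) (huv : Tendsto (fun i => v i / u i) l (𝓝 c)) :
    Tendsto (fun i => h (v i) / h (u i)) l (𝓝 (c ^ α)) := by
  have hu0 : ∀ᶠ i in l, 0 < u i := hu.eventually self_mem_nhdsWithin
  have hut : Tendsto u l (𝓝 0) := hu.mono_right nhdsWithin_le_nhds
  have hcont : ContinuousAt (fun d : ℝ => d ^ α) c :=
    Real.continuousAt_rpow_const _ _ (Or.inl hc.ne')
  have small : ∀ d : ℝ, ∀ᶠ i in l, d * u i < 1 := fun d => by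
    have : Tendsto (fun i => d * u i) l (𝓝 (d * 0)) := hut.const_mul d
    exact this.eventually_lt_const (by simp)
  rw [tendsto_order]
  constructor
  · intro a ha
    have h1 : ∀ᶠ d in 𝓝[<] c, a < d ^ α :=
      (hcont.tendsto.mono_left nhdsWithin_le_nhds).eventually_const_lt ha
    have h2 : ∀ᶠ d in 𝓝[<] c, 0 < d :=
      (Filter.Tendsto.mono_left tendsto_id nhdsWithin_le_nhds).eventually_const_lt hc
    obtain ⟨d, hd, hd0, hdc⟩ := (h1.and (h2.and self_mem_nhdsWithin)).exists
    have hdc : d < c := hdc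
    filter_upwards [hu0, huv.eventually_const_lt hdc, huv.eventually_lt_const (lt_add_one c),
      ((hreg d hd0).comp hu).eventually_const_lt hd, small (c + 1), small 1]
      with i hi h3 h4 h5 h6 h7
    rw [lt_div_iff₀ hi] at h3
    rw [div_lt_iff₀ hi] at h4
    have hdu : 0 < d * u i := by positivity
    refine lt_of_lt_of_le h5 ?_
    have := hpos (u i) ⟨hi, by linarith⟩
    simp only [Function.comp]
    gcongr
    exact hmono ⟨hdu, by linarith⟩ ⟨by linarith, by linarith⟩ h3.le
  · intro a ha
    have h1 : ∀ᶠ d in 𝓝[>] c, d ^ α < a :=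
      (hcont.tendsto.mono_left nhdsWithin_le_nhds).eventually_lt_const ha
    obtain ⟨d, hd, hdc⟩ := (h1.and self_mem_nhdsWithin).exists
    have hdc : c < d := hdc
    have hd0 : 0 < d := hc.trans hdc
    filter_upwards [hu0, huv.eventually_const_lt hc, huv.eventually_lt_const hdc,
      ((hreg d hd0).comp hu).eventually_lt_const hd, small d, small 1]
      with i hi h3 h4 h5 h6 h7
    rw [lt_div_iff₀ hi, zero_mul] at h3
    rw [div_lt_iff₀ hi] at h4
    refine lt_of_le_of_lt ?_ h5
    have := hpos (u i) ⟨hi, by linarith⟩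
    simp only [Function.comp]
    gcongr
    exact hmono ⟨h3, by linarith⟩ ⟨by positivity, by linarith⟩ h4.le

/-- Monotonicity provides a limit at 0. If it were nonzero, h (x / 2) / h x would tend to 1 and not
to 2 ^ (-α) < 1. -/
theorem tendsto_zero_of_regular (hα : 0 < α) {h : ℝ → ℝ} (hmono : MonotoneOn h (Set.Ioc 0 1))
    (hpos : ∀ x ∈ Set.Ioc (0 : ℝ) 1, 0 < h x)
    (hreg : ∀ c : ℝ, 0 < c → Tendsto (fun x => h (c * x) / h x) (𝓝[>] 0) (𝓝 (c ^ α))) :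
    Tendsto h (𝓝[>] 0) (𝓝 0) := by
  have hbdd : BddBelow (h '' Set.Ioo 0 1) :=
    ⟨0, by rintro _ ⟨x, hx, rfl⟩; exact (hpos x ⟨hx.1, hx.2.le⟩).le⟩
  have ht := MonotoneOn.tendsto_nhdsWithin_Ioo_right (Set.nonempty_Ioo.2 (zero_lt_one (α := ℝ)))
    (hmono.mono Set.Ioo_subset_Ioc_self) hbdd
  set ℓ := sInf (h '' Set.Ioo 0 1)
  suffices hℓ : ℓ = 0 by rwa [hℓ] at ht
  by_contra hℓ
  have hhalf : Tendsto (fun x : ℝ => 1 / 2 * x) (𝓝[>] 0) (𝓝[>] 0) := by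
    refine tendsto_nhdsWithin_iff.2 ⟨?_, ?_⟩
    · have : Tendsto (fun x : ℝ => 1 / 2 * x) (𝓝 0) (𝓝 (1 / 2 * 0)) := tendsto_id.const_mul _
      rw [mul_zero] at this
      exact this.mono_left nhdsWithin_le_nhds
    · filter_upwards [self_mem_nhdsWithin] with x (hx : 0 < x)
      exact (by positivity : 0 < 1 / 2 * x)
  have h1 := ((ht.comp hhalf).div ht hℓ)
  have h2 := tendsto_nhds_unique h1 (hreg (1 / 2) (by norm_num))
  rw [div_self hℓ] at h2
  have := Real.rpow_lt_one (by norm_num : (0 : ℝ) ≤ 1 / 2) (by norm_num) hα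
  linarith

/-- The properties of `x ↦ f (1 - x) - (1 - x)`, for a critical generating function `f` in the
domain of attraction of a stable law of index `1 + α`, that determine the iterates of `f`. -/
structure IsRegularDecrement (g : ℝ → ℝ) (α : ℝ) : Prop where
  convexOn : ConvexOn ℝ (Set.Icc 0 1) g
  map_zero : g 0 = 0
  pos : ∀ x ∈ Set.Ioc (0 : ℝ) 1, 0 < g x
  lt_self : ∀ x ∈ Set.Ioc (0 : ℝ) 1, g x < x
  monotoneOn_sub : MonotoneOn (fun x => x - g x) (Set.Icc 0 1)
  regular : ∀ c : ℝ, 0 < c → Tendsto (fun x => g (c * x) / g x) (𝓝[>] 0) (𝓝 (c ^ (1 + α)))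

namespace IsRegularDecrement

theorem monotoneOn_div (H : IsRegularDecrement g α) :
    MonotoneOn (fun x => g x / x) (Set.Ioc 0 1) :=
  monotoneOn_div_self_of_convexOn H.convexOn H.map_zero

theorem div_pos (H : IsRegularDecrement g α) : ∀ x ∈ Set.Ioc (0 : ℝ) 1, 0 < g x / x :=
  fun x hx => _root_.div_pos (H.pos x hx) hx.1

theorem tendsto_div_ratio (H : IsRegularDecrement g α)
    {ι : Type*} {l : Filter ι} {u v : ι → ℝ} {c : ℝ} (hc : 0 < c)
    (hu : Tendsto u l (𝓝[>] 0)) (huv : Tendsto (fun i => v i / u i) l (𝓝 c)) :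
    Tendsto (fun i => (g (v i) / v i) / (g (u i) / u i)) l (𝓝 (c ^ α)) :=
  tendsto_ratio_of_monotoneOn H.monotoneOn_div H.div_pos
    (fun _ hc => tendsto_div_self_ratio H.regular hc) hc hu huv

theorem tendsto_div_zero (H : IsRegularDecrement g α) (hα : 0 < α) :
    Tendsto (fun x => g x / x) (𝓝[>] 0) (𝓝 0) :=
  tendsto_zero_of_regular hα H.monotoneOn_div H.div_pos
    (fun _ hc => tendsto_div_self_ratio H.regular hc)

/-- Rescaling by x turns secants of g near 0 into secants of t ^ (1 + α) at t = 1. -/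
theorem tendsto_secant (H : IsRegularDecrement g α) {c : ℝ} (hc : -1 < c) (hc0 : c ≠ 0) :
    Tendsto (fun x => (g ((1 + c) * x) - g x) / ((1 + c) * x - x) / (g x / x)) (𝓝[>] 0)
      (𝓝 (c⁻¹ • ((1 + c) ^ (1 + α) - 1 ^ (1 + α)))) := by
  have h := ((H.regular (1 + c) (by linarith)).sub_const 1).const_mul c⁻¹
  rw [Real.one_rpow, smul_eq_mul]
  refine h.congr' ?_
  filter_upwards [Ioc_mem_nhdsGT zero_lt_one] with x hx
  have h1 := (H.pos x hx).ne'
  have h2 := hx.1.ne'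
  have h3 : (1 + c) * x - x = c * x := by ring
  rw [h3]
  field_simp

/-- The slope of `g` over the interval `[x - g x, x]` is asymptotic to `(1 + α) g x / x`. -/
theorem tendsto_slope (H : IsRegularDecrement g α) (hα : 0 < α) :
    Tendsto (fun x => (g (x - g x) - g x) / (x - g x - x) / (g x / x)) (𝓝[>] 0)
      (𝓝 (1 + α)) := by
  have hd : HasDerivAt (fun t : ℝ => t ^ (1 + α)) (1 + α) 1 := by
    simpa using Real.hasDerivAt_rpow_const (x := 1) (p := 1 + α) (Or.inl one_ne_zero)
  have hs := hd.tendsto_slope_zero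
  have small : ∀ d : ℝ, ∀ᶠ x in 𝓝[>] (0 : ℝ), d * x < 1 := fun d => by
    have : Tendsto (fun x : ℝ => d * x) (𝓝 0) (𝓝 (d * 0)) := tendsto_id.const_mul d
    exact (this.mono_left nhdsWithin_le_nhds).eventually_lt_const (by simp)
  -- By convexity, secant slopes of g based at x increase with the other endpoint. Since g x = o(x),
  -- the endpoint x - g x eventually lies between (1 + c) x for a fixed c < 0 and (1 + c) x for a
  -- fixed c > 0; letting c tend to 0 brings both bounds to the derivative 1 + α of t ^ (1 + α) at
  -- 1.
  rw [tendsto_order]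
  constructor
  · intro a ha
    have h1 := (hs.mono_left (nhdsLT_le_nhdsNE 0)).eventually_const_lt ha
    have h2 : ∀ᶠ c in 𝓝[<] (0 : ℝ), c ∈ Set.Ioo (-1 : ℝ) 0 := Ioo_mem_nhdsLT (by norm_num)
    obtain ⟨c, hc, hc1, hc0⟩ := (h1.and h2).exists
    filter_upwards [(H.tendsto_secant hc1 hc0.ne).eventually_const_lt hc,
      Ioo_mem_nhdsGT zero_lt_one, (H.tendsto_div_zero hα).eventually_lt_const (neg_pos.2 hc0)]
      with x h3 hx h4
    have hx' : x ∈ Set.Ioc (0 : ℝ) 1 := ⟨hx.1, hx.2.le⟩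
    have hgx := H.pos x hx'
    have hgl := H.lt_self x hx'
    rw [div_lt_iff₀ hx.1] at h4
    refine h3.trans_le ?_
    have := (H.div_pos x hx').le
    gcongr ?_ / _
    refine H.convexOn.secant_mono ⟨hx.1.le, hx.2.le⟩ ⟨?_, ?_⟩
      ⟨by linarith, by linarith [hx.2]⟩ ?_ ?_ ?_
    · exact mul_nonneg (by linarith) hx.1.le
    · nlinarith [hx.1, hx.2]
    · nlinarith [hx.1]
    · linarith
    · nlinarith [hx.1]
  · intro a ha
    have h1 := (hs.mono_left (nhdsGT_le_nhdsNE 0)).eventually_lt_const ha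
    obtain ⟨c, hc, hc0⟩ := (h1.and self_mem_nhdsWithin).exists
    have hc0 : 0 < c := hc0
    filter_upwards [(H.tendsto_secant (by linarith) hc0.ne').eventually_lt_const hc,
      Ioo_mem_nhdsGT zero_lt_one, small (1 + c)] with x h3 hx h4
    have hx' : x ∈ Set.Ioc (0 : ℝ) 1 := ⟨hx.1, hx.2.le⟩
    have hgx := H.pos x hx'
    have hgl := H.lt_self x hx'
    refine lt_of_le_of_lt ?_ h3
    have := (H.div_pos x hx').le
    have hcx : 0 < c * x := mul_pos hc0 hx.1
    gcongr ?_ / _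
    refine H.convexOn.secant_mono ⟨hx.1.le, hx.2.le⟩ ⟨by linarith, by linarith⟩
      ⟨by linarith, by linarith⟩ ?_ ?_ ?_ <;> linarith

/-- With y = x - g x and h x = g x / x, the increment 1 / h y - 1 / h x equals (S - 1) / (y / x) /
(h y / h x), where S is the normalised slope of `tendsto_slope`. Here S tends to 1 + α and both
ratios tend to 1. -/
theorem tendsto_inv_increment (H : IsRegularDecrement g α) (hα : 0 < α) :
    Tendsto (fun x => (g (x - g x) / (x - g x))⁻¹ - (g x / x)⁻¹) (𝓝[>] 0) (𝓝 α) := by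
  have h0 := H.tendsto_div_zero hα
  have hratio : Tendsto (fun x => (x - g x) / x) (𝓝[>] 0) (𝓝 1) := by
    have := h0.const_sub 1
    rw [sub_zero] at this
    refine this.congr' ?_
    filter_upwards [self_mem_nhdsWithin] with x (hx : 0 < x)
    field_simp
  have h1 := H.tendsto_div_ratio zero_lt_one tendsto_id hratio
  rw [Real.one_rpow] at h1
  have h2 := ((((H.tendsto_slope hα).sub_const 1).div hratio one_ne_zero).div h1 one_ne_zero)
  rw [add_sub_cancel_left, div_one, div_one] at h2
  refine h2.congr' ?_
  filter_upwards [Ioo_mem_nhdsGT zero_lt_one] with x hx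
  have hx' : x ∈ Set.Ioc (0 : ℝ) 1 := ⟨hx.1, hx.2.le⟩
  have hgx := H.pos x hx'
  have hgl := H.lt_self x hx'
  have hy : 0 < x - g x := by linarith
  have hgy := H.pos (x - g x) ⟨hy, by linarith [hx.2]⟩
  have hx0 := hx.1
  have e : x - g x - x = - g x := by ring
  simp only [id, Pi.div_apply, e]
  generalize g (x - g x) = z at *
  field_simp
  ring


theorem iterate_mem (H : IsRegularDecrement g α) (n : ℕ) {x : ℝ} (hx : x ∈ Set.Ioc (0 : ℝ) 1) :
    (fun x : ℝ => x - g x)^[n] x ∈ Set.Ioc (0 : ℝ) 1 := by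
  induction n with
  | zero => simpa using hx
  | succ n ih =>
    rw [Function.iterate_succ_apply']
    have h1 := H.pos _ ih
    have h2 := H.lt_self _ ih
    exact ⟨by linarith, by linarith [ih.2]⟩

theorem iterate_one_mem (H : IsRegularDecrement g α) (n : ℕ) :
    (fun x : ℝ => x - g x)^[n] 1 ∈ Set.Ioc (0 : ℝ) 1 :=
  H.iterate_mem n ⟨zero_lt_one, le_rfl⟩

theorem iterate_succ_lt (H : IsRegularDecrement g α) (n : ℕ) :
    (fun x : ℝ => x - g x)^[n + 1] 1 < (fun x : ℝ => x - g x)^[n] 1 := by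
  rw [Function.iterate_succ_apply']
  linarith [H.pos _ (H.iterate_one_mem n)]

theorem iterate_strictAnti (H : IsRegularDecrement g α) :
    StrictAnti (fun n => (fun x : ℝ => x - g x)^[n] 1) :=
  strictAnti_nat_of_succ_lt H.iterate_succ_lt

theorem iterate_le_iterate (H : IsRegularDecrement g α) (n : ℕ) {x y : ℝ}
    (hx : x ∈ Set.Ioc (0 : ℝ) 1) (hy : y ∈ Set.Ioc (0 : ℝ) 1) (hxy : x ≤ y) :
    (fun x : ℝ => x - g x)^[n] x ≤ (fun x : ℝ => x - g x)^[n] y := by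
  induction n with
  | zero => simpa using hxy
  | succ n ih =>
    rw [Function.iterate_succ_apply', Function.iterate_succ_apply']
    exact H.monotoneOn_sub (Set.Ioc_subset_Icc_self (H.iterate_mem n hx))
      (Set.Ioc_subset_Icc_self (H.iterate_mem n hy)) ih

theorem tendsto_iterate (H : IsRegularDecrement g α) :
    Tendsto (fun n => (fun x : ℝ => x - g x)^[n] 1) atTop (𝓝[>] 0) := by
  set e := fun n => (fun x : ℝ => x - g x)^[n] 1 with he
  refine tendsto_nhdsWithin_iff.2 ⟨?_, .of_forall fun n => (H.iterate_one_mem n).1⟩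
  have hb : BddBelow (Set.range e) := ⟨0, by rintro _ ⟨n, rfl⟩; exact (H.iterate_one_mem n).1.le⟩
  have ht := tendsto_atTop_ciInf H.iterate_strictAnti.antitone hb
  set ℓ := ⨅ n, e n with hℓ
  have hle : ∀ n, ℓ ≤ e n := fun n => ciInf_le hb n
  suffices ℓ = 0 by rwa [this] at ht
  by_contra h0
  have hℓ0 : 0 < ℓ := lt_of_le_of_ne (le_ciInf fun n => (H.iterate_one_mem n).1.le) (Ne.symm h0)
  have hmem : ℓ ∈ Set.Ioc (0 : ℝ) 1 := ⟨hℓ0, (hle 0).trans (H.iterate_one_mem 0).2⟩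
  set q := g ℓ / ℓ
  have hq : 0 < q := H.div_pos ℓ hmem
  -- A positive limit ℓ would make g x / x at least q = g ℓ / ℓ along the orbit, hence force
  -- geometric decay. Continuity of g is not needed.
  have hstep : ∀ n, e (n + 1) ≤ (1 - q) * e n := by
    intro n
    have h1 := H.iterate_one_mem n
    have h2 : q ≤ g (e n) / e n := H.monotoneOn_div hmem h1 (hle n)
    rw [le_div_iff₀ h1.1] at h2
    have h3 : e (n + 1) = e n - g (e n) := Function.iterate_succ_apply' _ _ _
    rw [h3]; linarith
  have := le_of_tendsto_of_tendsto' (ht.comp (tendsto_add_atTop_nat 1)) (ht.const_mul (1 - q)) hstep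
  nlinarith

/-- Along the iterates, `g x / x` is asymptotic to `1 / (α n)`. -/
theorem tendsto_nat_mul_div_iterate (H : IsRegularDecrement g α) (hα : 0 < α) :
    Tendsto (fun n : ℕ => (n : ℝ) * (g ((fun x : ℝ => x - g x)^[n] 1) /
      (fun x : ℝ => x - g x)^[n] 1)) atTop (𝓝 α⁻¹) := by
  set e := fun n => (fun x : ℝ => x - g x)^[n] 1 with he
  have h1 : Tendsto (fun n => (g (e (n + 1)) / e (n + 1))⁻¹ - (g (e n) / e n)⁻¹) atTop (𝓝 α) := by
    refine ((H.tendsto_inv_increment hα).comp H.tendsto_iterate).congr fun n => ?_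
    have : e (n + 1) = e n - g (e n) := Function.iterate_succ_apply' _ _ _
    rw [this]; rfl
  have h2 := h1.cesaro
  simp_rw [Finset.sum_range_sub (fun n => (g (e n) / e n)⁻¹)] at h2
  have h3 : Tendsto (fun n : ℕ => (n : ℝ)⁻¹ * (g (e 0) / e 0)⁻¹) atTop (𝓝 (0 * (g (e 0) / e 0)⁻¹)) :=
    (tendsto_inv_atTop_nhds_zero_nat (𝕜 := ℝ)).mul_const _
  have h4 := (h2.add h3).inv₀ (by simpa using hα.ne')
  rw [zero_mul, add_zero] at h4
  refine h4.congr fun n => ?_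
  rw [← mul_add, sub_add_cancel, mul_inv, inv_inv, inv_inv]

theorem exists_iterate_lt_le (H : IsRegularDecrement g α) {u : ℝ} (hu : u ∈ Set.Ioc (0 : ℝ) 1) :
    ∃ k, (fun x : ℝ => x - g x)^[k + 1] 1 < u ∧ u ≤ (fun x : ℝ => x - g x)^[k] 1 := by
  classical
  have hex : ∃ k, (fun x : ℝ => x - g x)^[k] 1 < u :=
    ((H.tendsto_iterate.mono_right nhdsWithin_le_nhds).eventually_lt_const hu.1).exists
  have h0 : Nat.find hex ≠ 0 := by
    intro h
    have := Nat.find_spec hex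
    rw [h] at this
    exact absurd hu.2 (not_le.2 this)
  obtain ⟨k, hk⟩ := Nat.exists_eq_succ_of_ne_zero h0
  refine ⟨k, ?_, ?_⟩
  · have := Nat.find_spec hex
    rwa [hk] at this
  · exact not_lt.1 (Nat.find_min hex (by omega))

/-- The number of iterations needed to descend from `1` to `u` is asymptotic to
`u / (α g u)`. -/
theorem tendsto_mul_of_iterate_lt_le (H : IsRegularDecrement g α) (hα : 0 < α)
    {ι : Type*} {l : Filter ι} {u : ι → ℝ} (hu : Tendsto u l (𝓝[>] 0)) {k : ι → ℕ}
    (hk : ∀ᶠ i in l, (fun x : ℝ => x - g x)^[k i + 1] 1 < u i ∧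
      u i ≤ (fun x : ℝ => x - g x)^[k i] 1) :
    Tendsto k l atTop ∧ Tendsto (fun i => (k i : ℝ) * (g (u i) / u i)) l (𝓝 α⁻¹) := by
  have hktop : Tendsto k l atTop := by
    rw [tendsto_atTop]
    intro b
    filter_upwards [hk, (hu.mono_right nhdsWithin_le_nhds).eventually_lt_const
      (H.iterate_one_mem b).1] with i h1 h2
    by_contra! h3
    have := H.iterate_strictAnti.antitone (show k i + 1 ≤ b by omega)
    linarith
  refine ⟨hktop, ?_⟩
  have hup := (H.tendsto_nat_mul_div_iterate hα).comp hktop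
  have hk1 : Tendsto (fun i => k i + 1) l atTop := (tendsto_add_atTop_nat 1).comp hktop
  -- The lower bound compares u with the iterate of index k + 1, so the factor k must be traded for
  -- k + 1.
  have hfrac : Tendsto (fun i => (k i : ℝ) / (k i + 1)) l (𝓝 1) :=
    (tendsto_natCast_div_add_atTop (1 : ℝ)).comp hktop
  have hlow := hfrac.mul ((H.tendsto_nat_mul_div_iterate hα).comp hk1)
  rw [one_mul] at hlow
  have hupos : ∀ᶠ i in l, u i ∈ Set.Ioc (0 : ℝ) 1 := hu.eventually (Ioc_mem_nhdsGT zero_lt_one)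
  refine tendsto_of_tendsto_of_tendsto_of_le_of_le' hlow hup ?_ ?_
  · filter_upwards [hk, hupos] with i h1 h2
    have h3 := H.monotoneOn_div (H.iterate_one_mem (k i + 1)) h2 h1.1.le
    simp only [Function.comp]
    push_cast
    rw [← mul_assoc, div_mul_cancel₀ _ (by positivity)]
    gcongr
  · filter_upwards [hk, hupos] with i h1 h2
    have h3 := H.monotoneOn_div h2 (H.iterate_one_mem (k i)) h1.2
    simp only [Function.comp]
    gcongr

/-- Over `k n = o(n)` further steps the iterates decrease almost linearly. -/
theorem tendsto_iterate_sub (H : IsRegularDecrement g α) (hα : 0 < α) {k : ℕ → ℕ}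
    (hkpos : ∀ᶠ n in atTop, 0 < k n) (hkn : Tendsto (fun n => (k n : ℝ) / n) atTop (𝓝 0)) :
    Tendsto (fun n : ℕ => ((fun x : ℝ => x - g x)^[n] 1 - (fun x : ℝ => x - g x)^[n + k n] 1) *
      n / ((fun x : ℝ => x - g x)^[n] 1 * k n)) atTop (𝓝 α⁻¹) := by
  set e := fun n => (fun x : ℝ => x - g x)^[n] 1 with he
  have hmem : ∀ n, e n ∈ Set.Ioc (0 : ℝ) 1 := H.iterate_one_mem
  have hanti : Antitone e := H.iterate_strictAnti.antitone
  have hganti : Antitone (fun n => g (e n)) := by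
    intro a b hab
    have h1 := H.monotoneOn_div (hmem b) (hmem a) (hanti hab)
    simp only at h1 ⊢
    have e1 : ∀ n, g (e n) = g (e n) / e n * e n := fun n => by
      rw [div_mul_cancel₀ _ (hmem n).1.ne']
    rw [e1 a, e1 b]
    have := (H.div_pos _ (hmem a)).le
    have := (hmem b).1.le
    have := hanti hab
    gcongr
  have hstep : ∀ n, e n - e (n + 1) = g (e n) := fun n => by
    have : e (n + 1) = e n - g (e n) := Function.iterate_succ_apply' _ _ _
    rw [this]; ring
  have hsum : ∀ n k, e n - e (n + k) = ∑ j ∈ Finset.range k, g (e (n + j)) := by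
    intro n k
    have := Finset.sum_range_sub' (fun j => e (n + j)) k
    simp only [add_zero] at this
    rw [← this]
    exact Finset.sum_congr rfl fun j _ => hstep (n + j)
  have hub : ∀ n k, e n - e (n + k) ≤ k * g (e n) := by
    intro n k
    rw [hsum]
    have := Finset.sum_le_card_nsmul (Finset.range k) (fun j => g (e (n + j))) (g (e n))
      fun j _ => hganti (Nat.le_add_right n j)
    simpa using this
  have hlb : ∀ n k, k * g (e (n + k)) ≤ e n - e (n + k) := by
    intro n k
    rw [hsum]
    have := Finset.card_nsmul_le_sum (Finset.range k) (fun j => g (e (n + j))) (g (e (n + k)))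
      fun j hj => hganti (by have := Finset.mem_range.1 hj; omega)
    simpa using this
  have hmain := H.tendsto_nat_mul_div_iterate hα
  have hshift : Tendsto (fun n => n + k n) atTop atTop :=
    tendsto_atTop_mono (fun n => Nat.le_add_right n _) tendsto_id
  -- The ratio is at least 1 - k h(e n) = 1 - (k / n) (n h(e n)) with h x = g x / x, and the second
  -- factor stays bounded.
  have hratio : Tendsto (fun n => e (n + k n) / e n) atTop (𝓝 1) := by
    have h1 : Tendsto (fun n : ℕ => 1 - (k n : ℝ) / n * (n * (g (e n) / e n))) atTop (𝓝 1) := by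
      simpa using (hkn.mul hmain).const_sub 1
    refine tendsto_of_tendsto_of_tendsto_of_le_of_le' h1 tendsto_const_nhds ?_ ?_
    · filter_upwards [eventually_gt_atTop 0] with n hn
      have hn' : (0 : ℝ) < n := by exact_mod_cast hn
      rw [le_div_iff₀ (hmem n).1]
      have := hub n (k n)
      have h0 := (hmem n).1.ne'
      have : (1 - (k n : ℝ) / n * (n * (g (e n) / e n))) * e n = e n - k n * g (e n) := by
        field_simp
      linarith
    · exact .of_forall fun n => div_le_one_of_le₀ (hanti (Nat.le_add_right _ _)) (hmem n).1.le
  have hfrac : Tendsto (fun n : ℕ => (n : ℝ) / ((n + k n : ℕ) : ℝ)) atTop (𝓝 1) := by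
    have h1 : Tendsto (fun n : ℕ => (1 + (k n : ℝ) / n)⁻¹) atTop (𝓝 (1 + 0)⁻¹) :=
      (hkn.const_add 1).inv₀ (by norm_num)
    simp only [add_zero, inv_one] at h1
    refine h1.congr' ?_
    filter_upwards [eventually_gt_atTop 0] with n hn
    have hn' : (0 : ℝ) < n := by exact_mod_cast hn
    push_cast
    field_simp
  have hlow := (hratio.mul hfrac).mul (hmain.comp hshift)
  rw [one_mul, one_mul] at hlow
  refine tendsto_of_tendsto_of_tendsto_of_le_of_le' hlow hmain ?_ ?_
  · filter_upwards [hkpos, eventually_gt_atTop 0] with n hk hn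
    have hk' : (0 : ℝ) < k n := by exact_mod_cast hk
    have hn' : (0 : ℝ) < n := by exact_mod_cast hn
    have h0 := (hmem n).1
    have h1 := (hmem (n + k n)).1
    have h2 : (0 : ℝ) < ((n + k n : ℕ) : ℝ) := by exact_mod_cast (by omega)
    simp only [Function.comp]
    rw [le_div_iff₀ (by positivity)]
    calc _ = k n * g (e (n + k n)) * n := by
          show e (n + k n) / e n * (n / ((n + k n : ℕ) : ℝ)) * (((n + k n : ℕ) : ℝ) *
            (g (e (n + k n)) / e (n + k n))) * (e n * k n) = _
          field_simp
      _ ≤ _ := by gcongr; exact hlb n (k n)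
  · filter_upwards [hkpos] with n hk
    have hk' : (0 : ℝ) < k n := by exact_mod_cast hk
    have h0 := (hmem n).1
    rw [div_le_iff₀ (by positivity)]
    calc (e n - e (n + k n)) * n ≤ (k n * g (e n)) * n := by gcongr; exact hub n (k n)
      _ = _ := by
        show _ = (n : ℝ) * (g (e n) / e n) * (e n * k n)
        field_simp

/-- Asymptotics of the `n`-th iterate started from `1 - exp (-c e)`, where `e` is the `m n`-th
iterate of `1` and `m n = o(n)`. -/
theorem tendsto_iterate_sub_exp (H : IsRegularDecrement g α) (hα : 0 < α) {m : ℕ → ℕ}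
    (hm : Tendsto m atTop atTop) (hmn : Tendsto (fun n => (m n : ℝ) / n) atTop (𝓝 0))
    {c : ℝ} (hc : 0 < c) :
    Tendsto (fun n : ℕ => ((fun x : ℝ => x - g x)^[n] 1 - (fun x : ℝ => x - g x)^[n]
      (1 - Real.exp (-c * (fun x : ℝ => x - g x)^[m n] 1))) *
      n / ((fun x : ℝ => x - g x)^[n] 1 * m n)) atTop (𝓝 (α⁻¹ * c ^ (-α))) := by
  set e := fun n => (fun x : ℝ => x - g x)^[n] 1 with he
  have hmem : ∀ n, e n ∈ Set.Ioc (0 : ℝ) 1 := H.iterate_one_mem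
  set u := fun n => 1 - Real.exp (-c * e (m n)) with hu
  have humem : ∀ n, u n ∈ Set.Ioc (0 : ℝ) 1 := fun n => by
    have : -c * e (m n) < 0 := by have := mul_pos hc (hmem (m n)).1; linarith
    have h1 : Real.exp (-c * e (m n)) < 1 := by rwa [← Real.exp_zero, Real.exp_lt_exp]
    have h2 := Real.exp_pos (-c * e (m n))
    simp only [hu, Set.mem_Ioc]
    constructor <;> linarith
  have hem : Tendsto (fun n => e (m n)) atTop (𝓝[>] 0) := H.tendsto_iterate.comp hm
  have hem0 : Tendsto (fun n => e (m n)) atTop (𝓝 0) := hem.mono_right nhdsWithin_le_nhds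
  have hu0 : Tendsto u atTop (𝓝[>] 0) := by
    refine tendsto_nhdsWithin_iff.2 ⟨?_, .of_forall fun n => (humem n).1⟩
    have h1 : Continuous fun x : ℝ => 1 - Real.exp (-c * x) := by fun_prop
    have := (h1.tendsto 0).comp hem0
    simp only [mul_zero, Real.exp_zero, sub_self] at this
    exact this
  have hue : Tendsto (fun n => u n / e (m n)) atTop (𝓝 c) := by
    have hd : HasDerivAt (fun x : ℝ => 1 - Real.exp (-c * x)) c 0 := by
      have := (((hasDerivAt_id (0 : ℝ)).const_mul (-c)).exp).const_sub 1
      simpa using this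
    have h1 := (hd.tendsto_slope_zero_right).comp hem
    refine h1.congr fun n => ?_
    simp [hu, div_eq_inv_mul]
  choose k hk1 hk2 using fun n => H.exists_iterate_lt_le (humem n)
  obtain ⟨hktop, hkh⟩ := H.tendsto_mul_of_iterate_lt_le hα hu0
    (.of_forall fun n => ⟨hk1 n, hk2 n⟩)
  have hmpos : ∀ᶠ n in atTop, 0 < m n := hm.eventually_gt_atTop 0
  -- With h x = g x / x, both k h(u) and m h(e_m) tend to 1 / α, while h(u) / h(e_m) tends to c ^ α.
  have hkm : Tendsto (fun n => (k n : ℝ) / m n) atTop (𝓝 (c ^ (-α))) := by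
    have h1 := (hkh.div ((H.tendsto_nat_mul_div_iterate hα).comp hm) (inv_ne_zero hα.ne')).div
      (H.tendsto_div_ratio hc hem hue) (Real.rpow_pos_of_pos hc α).ne'
    rw [div_self (inv_ne_zero hα.ne'), one_div, ← Real.rpow_neg hc.le] at h1
    refine h1.congr' ?_
    filter_upwards [hmpos] with n hn
    have h2 := H.div_pos _ (humem n)
    have h3 := H.div_pos _ (hmem (m n))
    have h4 : (0 : ℝ) < m n := by exact_mod_cast hn
    show k n * (g (u n) / u n) / (m n * (g (e (m n)) / e (m n))) /
      (g (u n) / u n / (g (e (m n)) / e (m n))) = _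
    generalize g (u n) / u n = a at *
    generalize g (e (m n)) / e (m n) = b at *
    field_simp
  have hminv : Tendsto (fun n => 1 / (m n : ℝ)) atTop (𝓝 0) :=
    (tendsto_one_div_atTop_nhds_zero_nat (𝕜 := ℝ)).comp hm
  have hkm1 : Tendsto (fun n => ((k n + 1 : ℕ) : ℝ) / m n) atTop (𝓝 (c ^ (-α))) := by
    have := hkm.add hminv
    rw [add_zero] at this
    refine this.congr fun n => ?_
    push_cast; ring
  -- Used for j = k and j = k + 1: T^n is monotone, so the n-th iterate of u is squeezed between the
  -- iterates of 1 of indices n + k + 1 and n + k.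
  have key : ∀ j : ℕ → ℕ, (∀ᶠ n in atTop, 0 < j n) →
      Tendsto (fun n => (j n : ℝ) / m n) atTop (𝓝 (c ^ (-α))) →
      Tendsto (fun n => (e n - e (n + j n)) * n / (e n * m n)) atTop (𝓝 (α⁻¹ * c ^ (-α))) := by
    intro j hj hjm
    have hjn : Tendsto (fun n => (j n : ℝ) / n) atTop (𝓝 0) := by
      have := hjm.mul hmn
      rw [mul_zero] at this
      refine this.congr' ?_
      filter_upwards [hmpos] with n hn
      have h4 : (0 : ℝ) < m n := by exact_mod_cast hn
      field_simp
    refine ((H.tendsto_iterate_sub hα hj hjn).mul hjm).congr' ?_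
    filter_upwards [hmpos, hj] with n hn hjn
    have h4 : (0 : ℝ) < m n := by exact_mod_cast hn
    have h5 : (0 : ℝ) < j n := by exact_mod_cast hjn
    have h6 := (hmem n).1
    show (e n - e (n + j n)) * n / (e n * j n) * (j n / m n) = _
    field_simp
  refine tendsto_of_tendsto_of_tendsto_of_le_of_le
    (key k (hktop.eventually_gt_atTop 0) hkm)
    (key (fun n => k n + 1) (.of_forall fun n => Nat.succ_pos _) hkm1) ?_ ?_
  · intro n
    have h1 := H.iterate_le_iterate n (humem n) (hmem (k n)) (hk2 n)
    simp only [he, ← Function.iterate_add_apply] at h1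
    have := (hmem n).1
    simp only
    gcongr
  · intro n
    have h1 := H.iterate_le_iterate n (hmem (k n + 1)) (humem n) (hk1 n).le
    simp only [he, ← Function.iterate_add_apply] at h1
    have := (hmem n).1
    simp only
    gcongr

end IsRegularDecrement

end RegularVariation

/-! ### Generating functions on [0, 1]. -/

section GeneratingFunction

variable {ν : Measure ℕ} [IsProbabilityMeasure ν]

theorem integrable_pow_pgf {s : ℝ} (hs : s ∈ Set.Icc (0 : ℝ) 1) :
    Integrable (fun k : ℕ => s ^ k) ν := by
  refine Integrable.of_bound (measurable_of_countable _).aestronglyMeasurable 1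
    (.of_forall fun k => ?_)
  rw [Real.norm_of_nonneg (pow_nonneg hs.1 k)]
  exact pow_le_one₀ hs.1 hs.2

theorem pgf_one : pgf ν 1 = 1 := by simp [pgf]

theorem pgf_monotoneOn : MonotoneOn (pgf ν) (Set.Icc 0 1) := fun _ hs _ ht hst =>
  integral_mono (integrable_pow_pgf hs) (integrable_pow_pgf ht)
    fun k => pow_le_pow_left₀ hs.1 hst k

theorem pgf_mem_Icc {s : ℝ} (hs : s ∈ Set.Icc (0 : ℝ) 1) : pgf ν s ∈ Set.Icc (0 : ℝ) 1 := by
  refine ⟨integral_nonneg fun k => pow_nonneg hs.1 k, ?_⟩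
  rw [← pgf_one (ν := ν)]
  exact pgf_monotoneOn hs ⟨zero_le_one, le_rfl⟩ hs.2

theorem pgf_convexOn : ConvexOn ℝ (Set.Icc 0 1) (pgf ν) := by
  refine ⟨convex_Icc 0 1, fun x hx y hy a b ha hb hab => ?_⟩
  have hxy := convex_Icc (0 : ℝ) 1 hx hy ha hb hab
  simp only [smul_eq_mul, pgf] at hxy ⊢
  rw [← integral_const_mul, ← integral_const_mul, ← integral_add
    ((integrable_pow_pgf hx).const_mul _) ((integrable_pow_pgf hy).const_mul _)]
  refine integral_mono (integrable_pow_pgf hxy)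
    (((integrable_pow_pgf hx).const_mul _).add ((integrable_pow_pgf hy).const_mul _)) fun k => ?_
  exact (convexOn_pow k).2 hx.1 hy.1 ha hb hab

/-- Equality would force s ^ k = 1 almost surely, hence k = 0 almost surely and mean zero. -/
theorem pgf_lt_one (hmean : ∫ k, (k : ℝ) ∂ν ≠ 0) {s : ℝ} (hs : s ∈ Set.Ico (0 : ℝ) 1) :
    pgf ν s < 1 := by
  have hs' : s ∈ Set.Icc (0 : ℝ) 1 := ⟨hs.1, hs.2.le⟩
  refine lt_of_le_of_ne (pgf_mem_Icc hs').2 fun h => hmean ?_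
  have h1 : ∫ k : ℕ, (1 - s ^ k) ∂ν = 0 := by
    rw [integral_sub (integrable_const _) (integrable_pow_pgf hs')]
    simp only [pgf] at h
    simp [h]
  rw [integral_eq_zero_iff_of_nonneg
    (fun k => sub_nonneg.2 (pow_le_one₀ hs'.1 hs'.2))
    ((integrable_const _).sub (integrable_pow_pgf hs'))] at h1
  refine integral_eq_zero_of_ae ?_
  filter_upwards [h1] with k hk
  by_contra hk0
  have hk0 : k ≠ 0 := by simpa using hk0
  have := pow_lt_one₀ hs.1 hs.2 hk0
  simp only [Pi.zero_apply] at hk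
  linarith

theorem isRegularDecrement_pgf {α : ℝ} {L : ℝ → ℝ} (hL : SlowlyVaryingAtZero L)
    (hmean : ∫ k, (k : ℝ) ∂ν ≠ 0)
    (hf : ∀ s ∈ Set.Icc (0 : ℝ) 1, pgf ν s = s + (1 - s) ^ (1 + α) * L (1 - s)) :
    IsRegularDecrement (fun x => pgf ν (1 - x) - (1 - x)) α := by
  have hg : ∀ x ∈ Set.Icc (0 : ℝ) 1, pgf ν (1 - x) - (1 - x) = x ^ (1 + α) * L x := by
    intro x hx
    rw [hf (1 - x) ⟨by linarith [hx.2], by linarith [hx.1]⟩]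
    simp
  have hconv : ConvexOn ℝ (Set.Icc 0 1) (fun x => pgf ν (1 - x) - (1 - x)) := by
    refine ⟨convex_Icc 0 1, fun x hx y hy a b ha hb hab => ?_⟩
    have h1 := (pgf_convexOn (ν := ν)).2 (x := 1 - x) ⟨by linarith [hx.2], by linarith [hx.1]⟩
      (y := 1 - y) ⟨by linarith [hy.2], by linarith [hy.1]⟩ ha hb hab
    simp only [smul_eq_mul] at h1 ⊢
    have e : a * (1 - x) + b * (1 - y) = 1 - (a * x + b * y) := by linear_combination hab
    rw [e] at h1
    linarith
  have h0 : pgf ν (1 - 0) - (1 - 0) = 0 := by simp [pgf_one]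
  refine ⟨hconv, h0, ?_, ?_, ?_, ?_⟩
  · intro x hx
    -- `L` is known to be positive only near 0. Monotonicity of g x / x carries positivity from a
    -- small y to all of (0, 1].
    obtain ⟨y, hy, hy1⟩ := (hL.1.and (Ioo_mem_nhdsGT hx.1)).exists
    have hy' : y ∈ Set.Ioc (0 : ℝ) 1 := ⟨hy1.1, hy1.2.le.trans hx.2⟩
    have h1 := monotoneOn_div_self_of_convexOn hconv h0 hy' hx hy1.2.le
    simp only at h1
    rw [hg y (Set.Ioc_subset_Icc_self hy')] at h1
    have h2 : 0 < y ^ (1 + α) * L y / y := by have := hy1.1; positivity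
    have h3 := h2.trans_le h1
    exact (div_pos_iff_of_pos_right hx.1).1 h3
  · intro x hx
    have := pgf_lt_one hmean (s := 1 - x) ⟨by linarith [hx.2], by linarith [hx.1]⟩
    linarith
  · intro x hx y hy hxy
    have := pgf_monotoneOn (ν := ν) (a := 1 - y) ⟨by linarith [hy.2], by linarith [hy.1]⟩
      (b := 1 - x) ⟨by linarith [hx.2], by linarith [hx.1]⟩ (by linarith)
    simp only
    linarith
  · intro c hc
    have h1 := (hL.2 c hc).const_mul (c ^ (1 + α))
    rw [mul_one] at h1
    refine h1.congr' ?_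
    have hsmall : (0 : ℝ) < 1 / c := by positivity
    filter_upwards [Ioo_mem_nhdsGT zero_lt_one, Ioo_mem_nhdsGT hsmall, hL.1] with x hx hx2 hLx
    have hx0 := hx.1
    have hcx : c * x ≤ 1 := by
      have := hx2.2.le
      rw [le_div_iff₀ hc] at this
      linarith
    rw [hg x ⟨hx.1.le, hx.2.le⟩, hg (c * x) ⟨by positivity, hcx⟩, Real.mul_rpow hc.le hx0.le]
    have : x ^ (1 + α) ≠ 0 := (Real.rpow_pos_of_pos hx0 _).ne'
    field_simp

end GeneratingFunction

theorem iterate_decrement_pgf (ν : Measure ℕ) (n : ℕ) (x : ℝ) :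
    (fun x : ℝ => x - (pgf ν (1 - x) - (1 - x)))^[n] x = 1 - (pgf ν)^[n] (1 - x) := by
  induction n with
  | zero => simp
  | succ n ih =>
    rw [Function.iterate_succ_apply', ih, Function.iterate_succ_apply']
    simp only [sub_sub_cancel]
    ring

/-! ### Continuity theorem for Laplace transforms. -/

section LaplaceTransform

/-- A continuous function vanishing on `[R, ∞)` is approximated, relative to `exp (-x)`, by
polynomials in `exp (-x)` without constant term. -/
theorem exists_polynomial_near_exp_neg {w : ℝ → ℝ} (hw : Continuous w) {R : ℝ}
    (hwR : ∀ x, R ≤ x → w x = 0) {η : ℝ} (hη : 0 < η) :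
    ∃ p : Polynomial ℝ, ∀ x, 0 ≤ x →
      |w x - Real.exp (-x) * p.eval (Real.exp (-x))| ≤ η * Real.exp (-x) := by
  -- Substitute t = exp (-x) in w x / exp (-x) and apply Weierstrass on [0, 1]. The maximum removes
  -- the singularity at t = 0 harmlessly, because w vanishes from R on.
  set W : ℝ → ℝ := fun t => w (-Real.log (max t (Real.exp (-R)))) / max t (Real.exp (-R)) with hWdef
  have hpos : ∀ t, max t (Real.exp (-R)) ≠ 0 := fun t =>
    (lt_max_of_lt_right (Real.exp_pos _)).ne'
  have hW : Continuous W := by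
    have h1 : Continuous fun t => max t (Real.exp (-R)) := by fun_prop
    exact (hw.comp (h1.log hpos).neg).div h1 hpos
  obtain ⟨p, hp⟩ := exists_polynomial_near_of_continuousOn 0 1 W hW.continuousOn η hη
  refine ⟨p, fun x hx => ?_⟩
  have hE := Real.exp_pos (-x)
  have h1 := hp (Real.exp (-x)) ⟨hE.le, Real.exp_le_one_iff.2 (by linarith)⟩
  have h2 : Real.exp (-x) * W (Real.exp (-x)) = w x := by
    rcases le_total x R with h | h
    · have h3 : max (Real.exp (-x)) (Real.exp (-R)) = Real.exp (-x) :=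
        max_eq_left (Real.exp_le_exp.2 (by linarith))
      simp only [hWdef, h3, Real.log_exp, neg_neg]
      field_simp
    · have h3 : max (Real.exp (-x)) (Real.exp (-R)) = Real.exp (-R) :=
        max_eq_right (Real.exp_le_exp.2 (by linarith))
      simp only [hWdef, h3, Real.log_exp, neg_neg, hwR R le_rfl, hwR x h]
      simp
  rw [← h2, ← mul_sub, abs_mul, abs_of_pos hE, abs_sub_comm, mul_comm]
  gcongr

/-- The extra factor exp (-x) makes every exponent strictly negative for x > 0, so only transforms
at c > 0 occur; this is what allows infinite measures. -/
theorem exp_neg_mul_eval_eq_sum (p : Polynomial ℝ) (x : ℝ) :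
    Real.exp (-x) * p.eval (Real.exp (-x)) =
      ∑ i ∈ Finset.range (p.natDegree + 1), p.coeff i * Real.exp (-((i : ℝ) + 1) * x) := by
  rw [Polynomial.eval_eq_sum_range, Finset.mul_sum]
  refine Finset.sum_congr rfl fun i _ => ?_
  rw [← Real.exp_nat_mul, mul_left_comm, ← Real.exp_add]
  congr 2
  ring

variable {U : Measure ℝ}

theorem integrable_exp_neg_mul_eval
    (hint : ∀ c : ℝ, 0 < c → Integrable (fun x => Real.exp (-c * x)) U) (p : Polynomial ℝ) :
    Integrable (fun x => Real.exp (-x) * p.eval (Real.exp (-x))) U := by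
  simp_rw [exp_neg_mul_eval_eq_sum]
  exact integrable_finsetSum _ fun i _ => (hint _ (by positivity)).const_mul _

theorem integrable_of_continuous_of_vanishing
    (hint : ∀ c : ℝ, 0 < c → Integrable (fun x => Real.exp (-c * x)) U)
    (hU : ∀ᵐ x ∂U, 0 ≤ x) {w : ℝ → ℝ} (hw : Continuous w) {R : ℝ}
    (hwR : ∀ x, R ≤ x → w x = 0) : Integrable w U := by
  obtain ⟨p, hp⟩ := exists_polynomial_near_exp_neg hw hwR zero_lt_one
  have h1 : Integrable (fun x => Real.exp (-x)) U := by simpa using hint 1 zero_lt_one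
  refine ((integrable_exp_neg_mul_eval hint p).norm.add h1).mono' hw.aestronglyMeasurable ?_
  filter_upwards [hU] with x hx
  have h2 := hp x hx
  rw [one_mul] at h2
  have h3 := abs_sub_abs_le_abs_sub (w x) (Real.exp (-x) * p.eval (Real.exp (-x)))
  simp only [Pi.add_apply, Real.norm_eq_abs]
  linarith

theorem abs_integral_sub_integral_le
    (hint : ∀ c : ℝ, 0 < c → Integrable (fun x => Real.exp (-c * x)) U)
    (hU : ∀ᵐ x ∂U, 0 ≤ x) {w : ℝ → ℝ} (hwint : Integrable w U) {η : ℝ} {p : Polynomial ℝ}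
    (hp : ∀ x, 0 ≤ x → |w x - Real.exp (-x) * p.eval (Real.exp (-x))| ≤ η * Real.exp (-x)) :
    |∫ x, w x ∂U - ∫ x, Real.exp (-x) * p.eval (Real.exp (-x)) ∂U| ≤
      η * ∫ x, Real.exp (-x) ∂U := by
  have h1 : Integrable (fun x => Real.exp (-x)) U := by simpa using hint 1 zero_lt_one
  rw [← integral_sub hwint (integrable_exp_neg_mul_eval hint p), ← integral_const_mul]
  rw [← Real.norm_eq_abs]
  refine norm_integral_le_of_norm_le (h1.const_mul η) ?_
  filter_upwards [hU] with x hx using hp x hx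

variable {ι : Type*} {l : Filter ι} {V : ι → Measure ℝ}

theorem tendsto_integral_of_tendsto_laplace
    (hint : ∀ c : ℝ, 0 < c → Integrable (fun x => Real.exp (-c * x)) U)
    (hU : ∀ᵐ x ∂U, 0 ≤ x)
    (hVint : ∀ i, ∀ c : ℝ, 0 < c → Integrable (fun x => Real.exp (-c * x)) (V i))
    (hV : ∀ i, ∀ᵐ x ∂V i, 0 ≤ x)
    (hlim : ∀ c : ℝ, 0 < c → Tendsto (fun i => ∫ x, Real.exp (-c * x) ∂V i) l
      (𝓝 (∫ x, Real.exp (-c * x) ∂U)))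
    {w : ℝ → ℝ} (hw : Continuous w) {R : ℝ} (hwR : ∀ x, R ≤ x → w x = 0) :
    Tendsto (fun i => ∫ x, w x ∂V i) l (𝓝 (∫ x, w x ∂U)) := by
  rw [Metric.tendsto_nhds]
  intro ε hε
  set M := ∫ x, Real.exp (-x) ∂U with hM
  have hM0 : 0 ≤ M := integral_nonneg fun x => (Real.exp_pos _).le
  -- The three errors are η (M + 1) for `V i`, η M for `U`, and η for the polynomial integrals.
  set η := ε / (2 * M + 2) with hη
  have hη0 : 0 < η := by positivity
  obtain ⟨p, hp⟩ := exists_polynomial_near_exp_neg hw hwR hη0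
  have hMlim : Tendsto (fun i => ∫ x, Real.exp (-x) ∂V i) l (𝓝 M) := by
    simpa using hlim 1 zero_lt_one
  have hpoly : ∀ {μ : Measure ℝ}, (∀ c : ℝ, 0 < c → Integrable (fun x => Real.exp (-c * x)) μ) →
      ∫ x, Real.exp (-x) * p.eval (Real.exp (-x)) ∂μ = ∑ i ∈ Finset.range (p.natDegree + 1),
        p.coeff i * ∫ x, Real.exp (-((i : ℝ) + 1) * x) ∂μ := by
    intro μ hμ
    simp_rw [exp_neg_mul_eval_eq_sum]
    rw [integral_finsetSum _ fun i _ => (hμ _ (by positivity)).const_mul _]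
    simp_rw [integral_const_mul]
  have hplim : Tendsto (fun i => ∫ x, Real.exp (-x) * p.eval (Real.exp (-x)) ∂V i) l
      (𝓝 (∫ x, Real.exp (-x) * p.eval (Real.exp (-x)) ∂U)) := by
    rw [hpoly hint]
    simp_rw [fun i => hpoly (hVint i)]
    exact tendsto_finsetSum _ fun j _ => (hlim _ (by positivity)).const_mul _
  filter_upwards [hMlim.eventually_lt_const (lt_add_one M),
    (Metric.tendsto_nhds.1 hplim) η hη0] with i h1 h2
  have h3 := abs_integral_sub_integral_le (hVint i) (hV i)
    (integrable_of_continuous_of_vanishing (hVint i) (hV i) hw hwR) hp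
  have h4 := abs_integral_sub_integral_le hint hU
    (integrable_of_continuous_of_vanishing hint hU hw hwR) hp
  have h5 : η * ∫ x, Real.exp (-x) ∂V i ≤ η * (M + 1) := by gcongr
  have h6 : η * (2 * M + 2) = ε := div_mul_cancel₀ _ (by positivity)
  rw [Real.dist_eq] at h2 ⊢
  rw [abs_le] at h3 h4
  rw [abs_lt] at h2 ⊢
  constructor <;> nlinarith

/-- Continuous cutoff, equal to `1` up to `a` and to `0` from `b` on. -/
noncomputable def cutoff (a b x : ℝ) : ℝ := max 0 (min 1 ((b - x) / (b - a)))

theorem continuous_cutoff (a b : ℝ) : Continuous (cutoff a b) := by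
  unfold cutoff
  fun_prop

theorem cutoff_of_le {a b x : ℝ} (hab : a < b) (hx : b ≤ x) : cutoff a b x = 0 :=
  max_eq_left ((min_le_right _ _).trans (div_nonpos_of_nonpos_of_nonneg (by linarith)
    (by linarith)))

theorem cutoff_le_indicator {a b : ℝ} (hab : a < b) (x : ℝ) :
    cutoff a b x ≤ (Set.Iic b).indicator 1 x := by
  by_cases hx : x ≤ b
  · rw [Set.indicator_of_mem (Set.mem_Iic.2 hx)]
    exact max_le zero_le_one (min_le_left _ _)
  · rw [Set.indicator_of_notMem (by simpa using hx), cutoff_of_le hab (not_le.1 hx).le]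

theorem indicator_le_cutoff {a b : ℝ} (hab : a < b) (x : ℝ) :
    (Set.Iic a).indicator 1 x ≤ cutoff a b x := by
  by_cases hx : x ≤ a
  · rw [Set.indicator_of_mem (Set.mem_Iic.2 hx)]
    refine le_max_of_le_right (le_min le_rfl ?_)
    rw [Pi.one_apply, one_le_div (by linarith)]
    linarith
  · rw [Set.indicator_of_notMem (by simpa using hx)]
    exact le_max_left _ _

/-- Markov's inequality for exp (-x). -/
theorem measure_Iic_lt_top
    (hint : ∀ c : ℝ, 0 < c → Integrable (fun x => Real.exp (-c * x)) U) (b : ℝ) :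
    U (Set.Iic b) < ⊤ := by
  have h := (hint 1 zero_lt_one).measure_ge_lt_top (Real.exp_pos (-b))
  refine lt_of_le_of_lt (measure_mono fun x hx => ?_) h
  have hx : x ≤ b := hx
  exact Real.exp_le_exp.2 (by linarith)

theorem integrable_indicator_Iic
    (hint : ∀ c : ℝ, 0 < c → Integrable (fun x => Real.exp (-c * x)) U) (b : ℝ) :
    Integrable ((Set.Iic b).indicator (1 : ℝ → ℝ)) U :=
  (integrable_indicator_iff measurableSet_Iic).2
    (integrableOn_const (measure_Iic_lt_top hint b).ne)

theorem measureReal_Iic_le_integral_cutoff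
    (hint : ∀ c : ℝ, 0 < c → Integrable (fun x => Real.exp (-c * x)) U)
    (hU : ∀ᵐ x ∂U, 0 ≤ x) {a b : ℝ} (hab : a < b) :
    U.real (Set.Iic a) ≤ ∫ x, cutoff a b x ∂U := by
  rw [← integral_indicator_one measurableSet_Iic]
  exact integral_mono (integrable_indicator_Iic hint a)
    (integrable_of_continuous_of_vanishing hint hU (continuous_cutoff a b)
      fun x hx => cutoff_of_le hab hx) (indicator_le_cutoff hab)

theorem integral_cutoff_le_measureReal_Iic
    (hint : ∀ c : ℝ, 0 < c → Integrable (fun x => Real.exp (-c * x)) U)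
    (hU : ∀ᵐ x ∂U, 0 ≤ x) {a b : ℝ} (hab : a < b) :
    ∫ x, cutoff a b x ∂U ≤ U.real (Set.Iic b) := by
  rw [← integral_indicator_one measurableSet_Iic]
  exact integral_mono (integrable_of_continuous_of_vanishing hint hU (continuous_cutoff a b)
      fun x hx => cutoff_of_le hab hx) (integrable_indicator_Iic hint b) (cutoff_le_indicator hab)

/-- Continuity theorem for Laplace transforms of possibly infinite measures on `[0, ∞)`. -/
theorem tendsto_measureReal_Iic_of_tendsto_laplace
    (hint : ∀ c : ℝ, 0 < c → Integrable (fun x => Real.exp (-c * x)) U)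
    (hU : ∀ᵐ x ∂U, 0 ≤ x)
    (hVint : ∀ i, ∀ c : ℝ, 0 < c → Integrable (fun x => Real.exp (-c * x)) (V i))
    (hV : ∀ i, ∀ᵐ x ∂V i, 0 ≤ x)
    (hlim : ∀ c : ℝ, 0 < c → Tendsto (fun i => ∫ x, Real.exp (-c * x) ∂V i) l
      (𝓝 (∫ x, Real.exp (-c * x) ∂U)))
    {b : ℝ} (hcont : ContinuousAt (fun x => U.real (Set.Iic x)) b) :
    Tendsto (fun i => (V i).real (Set.Iic b)) l (𝓝 (U.real (Set.Iic b))) := by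
  rw [tendsto_order]
  constructor
  · intro y hy
    obtain ⟨a, ha, hab⟩ := (((hcont.tendsto.mono_left nhdsWithin_le_nhds).eventually_const_lt
      hy).and (self_mem_nhdsWithin (s := Set.Iio b))).exists
    have h1 := tendsto_integral_of_tendsto_laplace hint hU hVint hV hlim (continuous_cutoff a b)
      (fun x hx => cutoff_of_le hab hx)
    filter_upwards [h1.eventually_const_lt
      (ha.trans_le (measureReal_Iic_le_integral_cutoff hint hU hab))] with i hi
    exact hi.trans_le (integral_cutoff_le_measureReal_Iic (hVint i) (hV i) hab)
  · intro y hy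
    obtain ⟨a, ha, hab⟩ := (((hcont.tendsto.mono_left nhdsWithin_le_nhds).eventually_lt_const
      hy).and (self_mem_nhdsWithin (s := Set.Ioi b))).exists
    have hab : b < a := hab
    have h1 := tendsto_integral_of_tendsto_laplace hint hU hVint hV hlim (continuous_cutoff b a)
      (fun x hx => cutoff_of_le hab hx)
    filter_upwards [h1.eventually_lt_const
      ((integral_cutoff_le_measureReal_Iic hint hU hab).trans_lt ha)] with i hi
    exact (measureReal_Iic_le_integral_cutoff (hVint i) (hV i) hab).trans_lt hi

end LaplaceTransform

/-! ### The limit measure. -/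

section PowerMeasure

/-- The measure with density `x ^ (α - 1) / Γ(α)` on `(0, ∞)`. -/
noncomputable def powerMeasure (α : ℝ) : Measure ℝ :=
  (volume.restrict (Set.Ioi 0)).withDensity
    fun x => ((x ^ (α - 1) / Real.Gamma α).toNNReal : ENNReal)

variable {α : ℝ}

theorem measurable_powerDensity :
    Measurable fun x : ℝ => (x ^ (α - 1) / Real.Gamma α).toNNReal := by fun_prop

theorem ae_nonneg_powerMeasure : ∀ᵐ x ∂powerMeasure α, 0 ≤ x := by
  refine (withDensity_absolutelyContinuous _ _).ae_le ?_
  filter_upwards [ae_restrict_mem measurableSet_Ioi] with x hx using le_of_lt hx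

theorem powerDensity_smul_exp (hα : 0 < α) (c : ℝ) {x : ℝ} (hx : x ∈ Set.Ioi (0 : ℝ)) :
    (x ^ (α - 1) / Real.Gamma α).toNNReal • Real.exp (-c * x) =
      (Real.Gamma α)⁻¹ * (x ^ (α - 1) * Real.exp (-(c * x))) := by
  have hx : 0 < x := hx
  have := Real.Gamma_pos_of_pos hα
  rw [NNReal.smul_def, Real.coe_toNNReal _ (by positivity), smul_eq_mul, neg_mul]
  ring

theorem integral_exp_powerMeasure (hα : 0 < α) {c : ℝ} (hc : 0 < c) :
    ∫ x, Real.exp (-c * x) ∂powerMeasure α = c ^ (-α) := by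
  rw [powerMeasure, integral_withDensity_eq_integral_smul measurable_powerDensity,
    setIntegral_congr_fun measurableSet_Ioi fun x hx => powerDensity_smul_exp hα c hx,
    integral_const_mul, Real.integral_rpow_mul_exp_neg_mul_Ioi hα hc, Real.rpow_neg hc.le,
    one_div, Real.inv_rpow hc.le]
  have := (Real.Gamma_pos_of_pos hα).ne'
  field_simp

theorem integrable_exp_powerMeasure (hα : 0 < α) {c : ℝ} (hc : 0 < c) :
    Integrable (fun x => Real.exp (-c * x)) (powerMeasure α) := by
  -- A non-integrable function has integral 0 by convention, but the computed value c ^ (-α) is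
  -- positive.
  by_contra h
  have h1 := integral_exp_powerMeasure hα hc
  rw [integral_undef h] at h1
  exact (Real.rpow_pos_of_pos hc (-α)).ne h1

theorem powerMeasure_real_Iic (hα : 0 < α) {b : ℝ} (hb : 0 ≤ b) :
    (powerMeasure α).real (Set.Iic b) = b ^ α / Real.Gamma (1 + α) := by
  have hΓ := Real.Gamma_pos_of_pos hα
  rw [← integral_indicator_one measurableSet_Iic, powerMeasure,
    integral_withDensity_eq_integral_smul measurable_powerDensity]
  have h1 : ∀ x ∈ Set.Ioi (0 : ℝ), (x ^ (α - 1) / Real.Gamma α).toNNReal •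
      (Set.Iic b).indicator (1 : ℝ → ℝ) x =
        (Set.Iic b).indicator (fun x => (Real.Gamma α)⁻¹ * x ^ (α - 1)) x := by
    intro x hx
    have hx : 0 < x := hx
    by_cases hxb : x ∈ Set.Iic b
    · rw [Set.indicator_of_mem hxb, Set.indicator_of_mem hxb, NNReal.smul_def,
        Real.coe_toNNReal _ (by positivity), smul_eq_mul, Pi.one_apply, mul_one]
      ring
    · rw [Set.indicator_of_notMem hxb, Set.indicator_of_notMem hxb, smul_zero]
  rw [setIntegral_congr_fun measurableSet_Ioi h1, setIntegral_indicator measurableSet_Iic,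
    Set.Ioi_inter_Iic, integral_const_mul, ← intervalIntegral.integral_of_le hb,
    integral_rpow (Or.inl (by linarith)), sub_add_cancel, Real.zero_rpow hα.ne', add_comm 1 α,
    Real.Gamma_add_one hα.ne']
  field_simp
  ring

theorem continuousAt_powerMeasure_real_Iic (hα : 0 < α) {b : ℝ} (hb : 0 < b) :
    ContinuousAt (fun x => (powerMeasure α).real (Set.Iic x)) b := by
  have h : ContinuousAt (fun x : ℝ => x ^ α / Real.Gamma (1 + α)) b :=
    (Real.continuousAt_rpow_const _ _ (Or.inl hb.ne')).div_const _
  refine h.congr ?_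
  filter_upwards [lt_mem_nhds hb] with x hx using (powerMeasure_real_Iic hα hx.le).symm

end PowerMeasure

/-! ### Generating function of the n-th generation. -/

section Branching

variable {Ω : Type*}

theorem measurable_random_sum [MeasurableSpace Ω] {N : Ω → ℕ} (hN : Measurable N)
    {X : ℕ → Ω → ℕ} (hX : ∀ i, Measurable (X i)) :
    Measurable fun ω => ∑ i ∈ Finset.range (N ω), X i ω := by
  have h : Measurable fun q : ℕ × Ω => ∑ i ∈ Finset.range q.1, X i q.2 :=
    measurable_from_prod_countable_right fun k =>
      Finset.measurable_sum (Finset.range k) fun i _ => hX i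
  exact h.comp (hN.prodMk measurable_id)

/-- The σ-algebra is left free so that it can be the one generated by the rows below n, as
independence requires. -/
theorem measurable_branching {m : MeasurableSpace Ω} {ξ : ℕ → ℕ → Ω → ℕ} (n : ℕ)
    (hξ : ∀ k < n, ∀ i, Measurable (ξ k i)) : Measurable (branching ξ n) := by
  induction n with
  | zero => exact measurable_const
  | succ n ih =>
    exact measurable_random_sum (ih fun k hk => hξ k (by omega)) (hξ n (by omega))

theorem branching_ae_congr [MeasurableSpace Ω] {P : Measure Ω} {ξ ξ' : ℕ → ℕ → Ω → ℕ}
    (h : ∀ n i, ξ n i =ᵐ[P] ξ' n i) (n : ℕ) : branching ξ n =ᵐ[P] branching ξ' n := by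
  have h' : ∀ᵐ ω ∂P, ∀ n i, ξ n i ω = ξ' n i ω := by
    rw [ae_all_iff]; intro n; rw [ae_all_iff]; exact h n
  filter_upwards [h'] with ω hω
  induction n with
  | zero => rfl
  | succ n ih =>
    simp only [branching]
    rw [ih]
    exact Finset.sum_congr rfl fun i _ => hω n i

variable [MeasurableSpace Ω] {P : Measure Ω}

/-- Generation n depends only on the rows k < n, whose index set is disjoint from row n. -/
theorem indepFun_branching {ξ : ℕ → ℕ → Ω → ℕ} (hmeas : ∀ n i, Measurable (ξ n i))
    (hind : iIndepFun (fun k : ℕ × ℕ => ξ k.1 k.2) P) (n : ℕ) :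
    IndepFun (branching ξ n) (fun ω i => ξ n i ω) P := by
  set S : Set (ℕ × ℕ) := {k | k.1 < n}
  set T : Set (ℕ × ℕ) := {k | k.1 = n}
  have hST : Disjoint S T := Set.disjoint_left.2 fun k hk hk' => by
    simp only [S, T, Set.mem_ofPred_eq] at hk hk'
    omega
  have h := indep_iSup_of_disjoint (m := fun k : ℕ × ℕ => MeasurableSpace.comap (ξ k.1 k.2) ⊤)
    (fun k => (hmeas k.1 k.2).comap_le) hind hST
  rw [IndepFun_iff_Indep]
  refine indep_of_indep_of_le_left (indep_of_indep_of_le_right h ?_) ?_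
  · refine Measurable.comap_le ?_
    refine @measurable_pi_lambda _ _ _ (_) _ _ fun i => ?_
    refine Measurable.of_comap_le ?_
    exact le_iSup₂_of_le (f := fun (k : ℕ × ℕ) (_ : k ∈ T) =>
      MeasurableSpace.comap (ξ k.1 k.2) ⊤) (n, i) rfl le_rfl
  · refine Measurable.comap_le ?_
    refine measurable_branching n fun k hk i => Measurable.of_comap_le ?_
    exact le_iSup₂_of_le (f := fun (k : ℕ × ℕ) (_ : k ∈ S) =>
      MeasurableSpace.comap (ξ k.1 k.2) ⊤) (k, i) hk le_rfl

theorem integral_pow_sum {ν : Measure ℕ} {X : ℕ → Ω → ℕ} (hX : ∀ i, HasLaw (X i) ν P)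
    (hind : iIndepFun X P) (s : ℝ) (k : ℕ) :
    ∫ ω, s ^ (∑ i ∈ Finset.range k, X i ω) ∂P = pgf ν s ^ k := by
  have h1 : iIndepFun (fun i : Fin k => X i) P := hind.precomp Fin.val_injective
  have h2 := h1.integral_fun_prod_comp (fun i => (hX i).aemeasurable)
    (f := fun _ j => s ^ j) (fun i => (measurable_of_countable _).aestronglyMeasurable)
  simp_rw [← Finset.prod_pow_eq_pow_sum, Finset.prod_range]
  rw [h2]
  have h3 : ∀ i : Fin k, ∫ ω, s ^ X i ω ∂P = pgf ν s := fun i => by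
    rw [pgf, ← (hX i).map_eq, integral_map (hX i).aemeasurable
      (measurable_of_countable _).aestronglyMeasurable]
  simp [h3]

variable [IsProbabilityMeasure P]

/-- Integrating out row n with generation n fixed replaces s by f(s), so the induction must hold for
all s. -/
theorem integral_pow_branching {ν : Measure ℕ} [IsProbabilityMeasure ν] {ξ : ℕ → ℕ → Ω → ℕ}
    (hmeas : ∀ n i, Measurable (ξ n i)) (hlaw : ∀ n i, HasLaw (ξ n i) ν P)
    (hind : iIndepFun (fun k : ℕ × ℕ => ξ k.1 k.2) P) (n : ℕ) {s : ℝ}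
    (hs : s ∈ Set.Icc (0 : ℝ) 1) :
    ∫ ω, s ^ branching ξ n ω ∂P = (pgf ν)^[n] s := by
  induction n generalizing s with
  | zero => simp [branching]
  | succ n ih =>
    have hB : Measurable (branching ξ n) := measurable_branching n fun k _ => hmeas k
    set X : Ω → ℕ → ℕ := fun ω i => ξ n i ω
    have hX : Measurable X := measurable_pi_lambda _ fun i => hmeas n i
    have hprod := (indepFun_iff_map_prod_eq_prod_map_map hB.aemeasurable hX.aemeasurable).1
      (indepFun_branching hmeas hind n)
    have : IsProbabilityMeasure (P.map (branching ξ n)) :=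
      Measure.isProbabilityMeasure_map hB.aemeasurable
    have : IsProbabilityMeasure (P.map X) := Measure.isProbabilityMeasure_map hX.aemeasurable
    set G : ℕ × (ℕ → ℕ) → ℝ := fun q => s ^ (∑ i ∈ Finset.range q.1, q.2 i) with hG
    have hGm : Measurable G := by
      have h : Measurable fun q : ℕ × (ℕ → ℕ) => ∑ i ∈ Finset.range q.1, q.2 i :=
        measurable_from_prod_countable_right fun k =>
          Finset.measurable_sum (Finset.range k) fun i _ => measurable_pi_apply i
      exact (measurable_of_countable fun j : ℕ => s ^ j).comp h
    have hGi : Integrable G ((P.map (branching ξ n)).prod (P.map X)) := by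
      refine Integrable.of_bound hGm.aestronglyMeasurable 1 (.of_forall fun q => ?_)
      rw [Real.norm_of_nonneg (pow_nonneg hs.1 _)]
      exact pow_le_one₀ hs.1 hs.2
    have hrow : iIndepFun (fun i => ξ n i) P :=
      hind.precomp (g := fun i : ℕ => (n, i)) fun i j h => by simpa using h
    calc ∫ ω, s ^ branching ξ (n + 1) ω ∂P = ∫ ω, G (branching ξ n ω, X ω) ∂P := rfl
      _ = ∫ k, ∫ x, G (k, x) ∂P.map X ∂P.map (branching ξ n) := by
        rw [← integral_map (φ := fun ω => (branching ξ n ω, X ω)) (f := G)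
          (hB.prodMk hX).aemeasurable hGm.aestronglyMeasurable, hprod, integral_prod _ hGi]
      _ = ∫ k, pgf ν s ^ k ∂P.map (branching ξ n) := by
        congr 1
        funext k
        have hGk : Measurable fun x => G (k, x) := hGm.comp (measurable_const.prodMk measurable_id)
        rw [integral_map hX.aemeasurable hGk.aestronglyMeasurable]
        exact integral_pow_sum (hlaw n) hrow s k
      _ = ∫ ω, pgf ν s ^ branching ξ n ω ∂P :=
        integral_map hB.aemeasurable (measurable_of_countable _).aestronglyMeasurable
      _ = (pgf ν)^[n + 1] s := by
        rw [ih (pgf_mem_Icc hs), Function.iterate_succ_apply]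

theorem IsGaltonWatson.aemeasurable_and_pgf_map {ν : Measure ℕ} [IsProbabilityMeasure ν]
    {Z : ℕ → Ω → ℕ} (hZ : IsGaltonWatson Z ν P) (n : ℕ) :
    AEMeasurable (Z n) P ∧
      ∀ s ∈ Set.Icc (0 : ℝ) 1, pgf (P.map (Z n)) s = (pgf ν)^[n] s := by
  obtain ⟨ξ, hlaw, hind, hZ⟩ := hZ
  -- `HasLaw` gives only a.e. measurability, so pass to measurable versions.
  set ξ' : ℕ → ℕ → Ω → ℕ := fun n i => (hlaw n i).aemeasurable.mk (ξ n i)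
  have hae : ∀ n i, ξ n i =ᵐ[P] ξ' n i := fun n i => (hlaw n i).aemeasurable.ae_eq_mk
  have hmeas : ∀ n i, Measurable (ξ' n i) := fun n i => (hlaw n i).aemeasurable.measurable_mk
  have hlaw' : ∀ n i, HasLaw (ξ' n i) ν P := fun n i => (hlaw n i).congr (hae n i).symm
  have hind' : iIndepFun (fun k : ℕ × ℕ => ξ' k.1 k.2) P := hind.congr fun k => hae k.1 k.2
  have hZ' : Z n =ᵐ[P] branching ξ' n := (hZ n).trans (branching_ae_congr hae n)
  have hB : Measurable (branching ξ' n) := measurable_branching n fun k _ => hmeas k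
  refine ⟨hB.aemeasurable.congr hZ'.symm, fun s hs => ?_⟩
  rw [pgf, Measure.map_congr hZ', integral_map hB.aemeasurable
    (measurable_of_countable _).aestronglyMeasurable]
  exact integral_pow_branching hmeas hlaw' hind' n hs

end Branching

/-! ### The rescaled law of the surviving population. -/

section ScaledLaw

/-- The law of `a * k` on the event `k ≠ 0`, with `k` of law `μ`, multiplied by `C`. -/
noncomputable def scaledLaw (μ : Measure ℕ) (a C : ℝ) : Measure ℝ :=
  ENNReal.ofReal C • (μ.restrict {0}ᶜ).map fun k : ℕ => a * (k : ℝ)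

variable {μ : Measure ℕ} {a C : ℝ}

theorem measurable_const_mul_natCast : Measurable fun k : ℕ => a * (k : ℝ) :=
  measurable_of_countable _

theorem ae_nonneg_scaledLaw (ha : 0 ≤ a) : ∀ᵐ x ∂scaledLaw μ a C, 0 ≤ x := by
  refine Measure.ae_smul_measure ?_ _
  rw [ae_map_iff measurable_const_mul_natCast.aemeasurable measurableSet_Ici]
  exact .of_forall fun k => by positivity

theorem scaledLaw_real_Iic (ha : 0 < a) (hC : 0 ≤ C) :
    (scaledLaw μ a C).real (Set.Iic 1) =
      C * μ.real {k : ℕ | 0 < a * (k : ℝ) ∧ a * (k : ℝ) ≤ 1} := by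
  rw [scaledLaw, measureReal_ennreal_smul_apply, ENNReal.toReal_ofReal hC,
    map_measureReal_apply measurable_const_mul_natCast measurableSet_Iic,
    measureReal_restrict_apply .of_discrete]
  congr 2
  ext k
  have : 0 < a * (k : ℝ) ↔ k ≠ 0 := by
    rw [mul_pos_iff_of_pos_left ha, Nat.cast_pos, Nat.pos_iff_ne_zero]
  simp [this, and_comm]

variable [IsProbabilityMeasure μ]

theorem integrable_exp_scaledLaw (ha : 0 ≤ a) {c : ℝ} (hc : 0 < c) :
    Integrable (fun x => Real.exp (-c * x)) (scaledLaw μ a C) := by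
  have : IsFiniteMeasure (scaledLaw μ a C) := by
    unfold scaledLaw
    exact Measure.smul_finite _ ENNReal.ofReal_ne_top
  refine Integrable.of_bound (by fun_prop) 1 ?_
  filter_upwards [ae_nonneg_scaledLaw ha] with x hx
  rw [Real.norm_of_nonneg (Real.exp_pos _).le]
  exact Real.exp_le_one_iff.2 (by nlinarith)

theorem integral_exp_scaledLaw (ha : 0 ≤ a) (hC : 0 ≤ C) {c : ℝ} (hc : 0 < c) :
    ∫ x, Real.exp (-c * x) ∂scaledLaw μ a C =
      C * (pgf μ (Real.exp (-c * a)) - pgf μ 0) := by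
  have hs : Real.exp (-c * a) ∈ Set.Icc (0 : ℝ) 1 :=
    ⟨(Real.exp_pos _).le, Real.exp_le_one_iff.2 (by nlinarith)⟩
  rw [scaledLaw, integral_smul_measure, ENNReal.toReal_ofReal hC, smul_eq_mul,
    integral_map measurable_const_mul_natCast.aemeasurable (by fun_prop),
    ← integral_indicator (MeasurableSet.of_discrete), pgf, pgf,
    ← integral_sub (integrable_pow_pgf hs) (integrable_pow_pgf ⟨le_rfl, zero_le_one⟩)]
  congr 2
  funext k
  -- At k = 0 both powers equal 1 (as 0 ^ 0 = 1) and cancel, matching the removed atom.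
  rcases eq_or_ne k 0 with rfl | hk
  · simp
  · rw [Set.indicator_of_mem (by simpa using hk), zero_pow hk, sub_zero, ← Real.exp_nat_mul]
    congr 1
    ring

end ScaledLaw

/-! ### Assembly of the asymptotics. -/

theorem theorem1 {Ω : Type*} [MeasurableSpace Ω] (P : Measure Ω) [IsProbabilityMeasure P]
    (ν : Measure ℕ) [IsProbabilityMeasure ν] (Z : ℕ → Ω → ℕ) (hZ : IsGaltonWatson Z ν P)
    (α : ℝ) (hα₀ : 0 < α) (hα₁ : α < 1) (L : ℝ → ℝ) (hL : SlowlyVaryingAtZero L)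
    (hmean_int : Integrable (fun k : ℕ => (k : ℝ)) ν) (hmean : ∫ k, (k : ℝ) ∂ν = 1)
    (hf : ∀ s ∈ Set.Icc (0 : ℝ) 1, pgf ν s = s + (1 - s) ^ (1 + α) * L (1 - s))
    (φ : ℕ → ℝ) (hφ : Tendsto φ atTop atTop)
    (hφn : Tendsto (fun n : ℕ => φ n / n) atTop (𝓝 0)) :
    (fun n : ℕ => P.real {ω | 0 < (1 - (pgf ν)^[⌊φ n⌋₊] 0) * (Z n ω : ℝ) ∧
        (1 - (pgf ν)^[⌊φ n⌋₊] 0) * (Z n ω : ℝ) ≤ 1})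
      ~[atTop]
    (fun n : ℕ => (1 - (pgf ν)^[n] 0) / (α * n) * (1 / Real.Gamma (1 + α)) * φ n) := by
  have H := isRegularDecrement_pgf hL (hmean ▸ one_ne_zero) hf
  set e : ℕ → ℝ := fun n => 1 - (pgf ν)^[n] 0 with he
  have hiter : ∀ n, (fun x : ℝ => x - (pgf ν (1 - x) - (1 - x)))^[n] 1 = e n := fun n => by
    rw [iterate_decrement_pgf, sub_self]
  have hepos : ∀ n, 0 < e n := fun n => hiter n ▸ (H.iterate_one_mem n).1
  set m : ℕ → ℕ := fun n => ⌊φ n⌋₊ with hmdef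
  have hm : Tendsto m atTop atTop := tendsto_nat_floor_atTop.comp hφ
  have hmφ : Tendsto (fun n => (m n : ℝ) / φ n) atTop (𝓝 1) :=
    (tendsto_nat_floor_div_atTop (R := ℝ)).comp hφ
  have hφpos : ∀ᶠ n in atTop, 0 < φ n := hφ.eventually_gt_atTop 0
  have hmn : Tendsto (fun n => (m n : ℝ) / n) atTop (𝓝 0) := by
    refine tendsto_of_tendsto_of_tendsto_of_le_of_le' tendsto_const_nhds hφn
      (.of_forall fun n => by positivity) ?_
    filter_upwards [hφpos] with n hn
    have := Nat.floor_le hn.le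
    gcongr
  -- The normalisation that makes the Laplace transforms converge to c ^ (-α) exactly.
  set C : ℕ → ℝ := fun n => α * n / (e n * m n) with hC
  have hC0 : ∀ n, 0 ≤ C n := fun n => by have := hepos n; positivity
  have hlaw : ∀ n, IsProbabilityMeasure (P.map (Z n)) := fun n =>
    Measure.isProbabilityMeasure_map (hZ.aemeasurable_and_pgf_map n).1
  have hlim : ∀ c : ℝ, 0 < c → Tendsto
      (fun n => ∫ x, Real.exp (-c * x) ∂scaledLaw (P.map (Z n)) (e (m n)) (C n)) atTop
      (𝓝 (∫ x, Real.exp (-c * x) ∂powerMeasure α)) := by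
    intro c hc
    rw [integral_exp_powerMeasure hα₀ hc]
    have h1 := (H.tendsto_iterate_sub_exp hα₀ hm hmn hc).const_mul α
    rw [← mul_assoc, mul_inv_cancel₀ hα₀.ne', one_mul] at h1
    refine h1.congr fun n => ?_
    have hs : Real.exp (-c * e (m n)) ∈ Set.Icc (0 : ℝ) 1 :=
      ⟨(Real.exp_pos _).le, Real.exp_le_one_iff.2 (by nlinarith [hepos (m n)])⟩
    rw [integral_exp_scaledLaw (hepos _).le (hC0 n) hc,
      (hZ.aemeasurable_and_pgf_map n).2 _ hs,
      (hZ.aemeasurable_and_pgf_map n).2 0 ⟨le_rfl, zero_le_one⟩]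
    simp only [hiter]
    rw [iterate_decrement_pgf, sub_sub_cancel]
    simp only [hC, he]
    ring
  have hmain := tendsto_measureReal_Iic_of_tendsto_laplace
    (fun c hc => integrable_exp_powerMeasure hα₀ hc) ae_nonneg_powerMeasure
    (fun n c hc => integrable_exp_scaledLaw (hepos (m n)).le hc)
    (fun n => ae_nonneg_scaledLaw (hepos (m n)).le) hlim
    (continuousAt_powerMeasure_real_Iic hα₀ zero_lt_one)
  have hΓ : 0 < Real.Gamma (1 + α) := Real.Gamma_pos_of_pos (by linarith)
  rw [powerMeasure_real_Iic hα₀ zero_le_one, Real.one_rpow] at hmain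
  have hprob : ∀ n, (scaledLaw (P.map (Z n)) (e (m n)) (C n)).real (Set.Iic 1) =
      C n * P.real {ω | 0 < e (m n) * (Z n ω : ℝ) ∧ e (m n) * (Z n ω : ℝ) ≤ 1} := fun n => by
    rw [scaledLaw_real_Iic (hepos _) (hC0 n), map_measureReal_apply_of_aemeasurable
      (hZ.aemeasurable_and_pgf_map n).1 .of_discrete]
    rfl
  simp_rw [hprob] at hmain
  have hφne : ∀ᶠ n : ℕ in atTop, 0 < n ∧ 0 < φ n ∧ 0 < m n :=
    (eventually_gt_atTop 0).and (hφpos.and (hm.eventually_gt_atTop 0))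
  rw [isEquivalent_iff_tendsto_one]
  · have h1 := (hmain.mul_const (Real.Gamma (1 + α))).mul hmφ
    rw [one_div_mul_cancel hΓ.ne', mul_one] at h1
    refine h1.congr' ?_
    filter_upwards [hφne] with n ⟨hn, hφ0, hm0⟩
    have hn' : (0 : ℝ) < n := by exact_mod_cast hn
    have hm' : (0 : ℝ) < m n := by exact_mod_cast hm0
    have hen := hepos n
    simp only [Pi.div_apply]
    show C n * P.real {ω | 0 < e (m n) * (Z n ω : ℝ) ∧ e (m n) * (Z n ω : ℝ) ≤ 1} *
      Real.Gamma (1 + α) * (m n / φ n) =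
      P.real {ω | 0 < e (m n) * (Z n ω : ℝ) ∧ e (m n) * (Z n ω : ℝ) ≤ 1} /
        (e n / (α * n) * (1 / Real.Gamma (1 + α)) * φ n)
    generalize P.real {ω | 0 < e (m n) * (Z n ω : ℝ) ∧ e (m n) * (Z n ω : ℝ) ≤ 1} = p
    simp only [hC]
    field_simp
  · filter_upwards [hφne] with n ⟨hn, hφ0, _⟩
    have hn' : (0 : ℝ) < n := by exact_mod_cast hn
    have hen := hepos n
    show e n / (α * n) * (1 / Real.Gamma (1 + α)) * φ n ≠ 0
    positivity
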